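/- Let $R=\mathbb{Z}_9+u\mathbb{Z}_9=\mathbb{Z}_9[u]/(u^2-u)$, let $p=12r+1$ be a prime, and let $R_p=R[X]/(X^p-1)$. Identify $(c_0,\dots,c_{p-1})\in R^p$ with $c_0+c_1X+\cdots+c_{p-1}X^{p-1}\in R_p$, so that ideals of $R_p$ are cyclic codes of length $p$ over $R$; for such a code $\mathcal C$ let $\mathcal C^\perp=\{\mathbf x\in R^p:\sum_i x_ic_i=0\text{ for all }\mathbf c\in\mathcal C\}$ be its Euclidean dual. Let $\mathcal Q_p$ and $\mathcal N_p$ be the sets of nonzero quadratic residues and of quadratic non-residues modulo $p$, and put $Q=\sum_{i\in\mathcal Q_p}X^i$, $N=\sum_{i\in\mathcal N_p}X^i$, $J=1+Q+N$ in $R_p$. For a positive integer $a$ let $\mu_a$ be the $R$-linear ring endomorphism of $R_p$ with $X^i\mapsto X^{ai}$, and let $\mathcal C\mu_a$ be the image of $\mathcal C$ under $\mu_a$. Define $$d(A,B)=\begin{cases}1+A & r\equiv0\\ 4+A+6B & r\equiv 1\\ 7+A+3B & r\equiv 2\end{cases}\pmod 3,\qquad e(A,B)=\begin{cases}8B & r\equiv0\\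 6+3A+8B & r\equiv 1\\ 3+6A+8B & r\equiv 2\end{cases}\pmod 3,$$ and the quadratic residue codes (principal ideals of $R_p$) $$\mathcal D_1=(u\,d(Q,N)+(1-u)\,d(N,Q)),\qquad \mathcal D_2=(u\,d(N,Q)+(1-u)\,d(Q,N)),$$ $$\mathcal E_1=(u\,e(Q,N)+(1-u)\,e(N,Q)),\qquad \mathcal E_2=(u\,e(N,Q)+(1-u)\,e(Q,N)).$$ Then there is an element $K\in\{J,4J,7J\}$ such that the following hold: (i) $\mathcal D_i\mu_a=\mathcal D_i$ and $\mathcal E_i\mu_a=\mathcal E_i$ for $i=1,2$ whenever $a \bmod p\in\mathcal Q_p$; $\mathcal D_1\mu_a=\mathcal D_2$ and $\mathcal E_1\mu_a=\mathcal E_2$ whenever $a\bmod p\in\mathcal N_p$. (ii) $\mathcal D_1\cap\mathcal D_2=(K)$ and $\mathcal D_1+\mathcal D_2=R_p$. (iii) $\mathcal E_1\cap\mathcal E_2=\{0\}$ and $\mathcal E_1+\mathcal E_2=(K)^\perp$. (iv) $|\mathcal D_1|=|\mathcal D_2|=9^{p+1}$ and $|\mathcal E_1|=|\mathcal E_2|=9^{p-1}$.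 (v) $\mathcal D_i=\mathcal E_i+(K)$ for $i=1,2$. (vi) $\mathcal E_1^\perp=\mathcal D_2$ and $\mathcal E_2^\perp=\mathcal D_1$. -/

import Mathlib

open Polynomial

noncomputable section

namespace QRCode

/-- The ring `R = ℤ₉ + uℤ₉` with `u² = u`, i.e. `ℤ₉[u] / (u² - u)`. -/
abbrev R : Type := AdjoinRoot (X ^ 2 - X : (ZMod 9)[X])

/-- The idempotent `u` of `R`. -/
def u : R := AdjoinRoot.root (X ^ 2 - X : (ZMod 9)[X])

/-- `R_n = R[X] / (X ^ n - 1)`. -/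
abbrev RX (n : ℕ) : Type := AdjoinRoot (X ^ n - 1 : R[X])

/-- The class of `X` in `R_n`. -/
def x (n : ℕ) : RX n := AdjoinRoot.root (X ^ n - 1 : R[X])

theorem x_pow (n : ℕ) : x n ^ n = 1 := by
  have h := AdjoinRoot.eval₂_root (X ^ n - 1 : R[X])
  rw [eval₂_sub, eval₂_pow, eval₂_X, eval₂_one, sub_eq_zero] at h
  exact h

/-- The identification `R ^ n → R_n`,
`(c₀, …, c_{n-1}) ↦ c₀ + c₁ X + ⋯ + c_{n-1} X ^ (n-1)`. -/
def toPoly (n : ℕ) : (Fin n → R) →ₗ[R] RX n :=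
  Fintype.linearCombination R (fun i : Fin n => x n ^ (i : ℕ))

/-- The cyclic code of length `n` (a submodule of `R ^ n`) identified with an ideal of `R_n`. -/
def code {n : ℕ} (I : Ideal (RX n)) : Submodule R (Fin n → R) :=
  (I.restrictScalars R).comap (toPoly n)

/-- The Euclidean dual code. -/
def dual {n : ℕ} (C : Submodule R (Fin n → R)) : Submodule R (Fin n → R) where
  carrier := {v | ∀ c ∈ C, ∑ i, v i * c i = 0}
  zero_mem' := by intro c _; simp
  add_mem' := by
    intro a b ha hb c hc
    simp only [Pi.add_apply, add_mul, Finset.sum_add_distrib, ha c hc, hb c hc, add_zero]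
  smul_mem' := by
    intro r a ha c hc
    simp only [Pi.smul_apply, smul_eq_mul, mul_assoc, ← Finset.mul_sum, ha c hc, mul_zero]

/-- The nonzero quadratic residues modulo `p`. -/
def residues (p : ℕ) : Set (ZMod p) := {a | a ≠ 0 ∧ IsSquare a}

/-- The quadratic non-residues modulo `p`. -/
def nonresidues (p : ℕ) : Set (ZMod p) := {a | ¬ IsSquare a}

open Classical in
/-- `Q(X) = ∑ X ^ i` over the nonzero quadratic residues `i`. -/
def Q (p : ℕ) : RX p := ∑ i ∈ (Finset.range p).filter (fun i : ℕ => (i : ZMod p) ∈ residues p), x p ^ i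

open Classical in
/-- `N(X) = ∑ X ^ i` over the quadratic non-residues `i`. -/
def N (p : ℕ) : RX p := ∑ i ∈ (Finset.range p).filter (fun i : ℕ => (i : ZMod p) ∈ nonresidues p), x p ^ i

/-- `J(X) = 1 + Q(X) + N(X)`. -/
def J (p : ℕ) : RX p := 1 + Q p + N p

/-- The map `μ_a` on `R_p`: it fixes `R` and sends `X ^ i` to `X ^ (a i)`. -/
def mu (p a : ℕ) : RX p →+* RX p :=
  AdjoinRoot.lift (AdjoinRoot.of (X ^ p - 1 : R[X])) (x p ^ a) (by
    rw [eval₂_sub, eval₂_pow, eval₂_X, eval₂_one, ← pow_mul, mul_comm, pow_mul, x_pow, one_pow,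
      sub_self])

/-- `u a + (1 - u) b` in `R_p`. -/
def comb {p : ℕ} (a b : RX p) : RX p := u • a + (1 - u) • b

/-- For `p = 12 r + 1`, the `u`-component of the generator of `D₁` is `genD r Q N`;
interchanging `Q` and `N` gives its `(1 - u)`-component. -/
def genD {p : ℕ} (r : ℕ) (a b : RX p) : RX p :=
  match r % 3 with
  | 0 => 1 + a
  | 1 => 4 + a + 6 * b
  | _ => 7 + a + 3 * b

/-- For `p = 12 r + 1`, the `u`-component of the generator of `E₁` is `genE r Q N`;
interchanging `Q` and `N` gives its `(1 - u)`-component. -/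
def genE {p : ℕ} (r : ℕ) (a b : RX p) : RX p :=
  match r % 3 with
  | 0 => 8 * b
  | 1 => 6 + 3 * a + 8 * b
  | _ => 3 + 6 * a + 8 * b

/-- The quadratic residue codes over `R` in case II, `p = 12 r + 1`, as ideals of `R_p`. -/
def D₁ (p r : ℕ) : Ideal (RX p) :=
  Ideal.span {comb (genD r (Q p) (N p)) (genD r (N p) (Q p))}

/-- The case II code `D₂`. -/
def D₂ (p r : ℕ) : Ideal (RX p) :=
  Ideal.span {comb (genD r (N p) (Q p)) (genD r (Q p) (N p))}

/-- The case II code `E₁`. -/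
def E₁ (p r : ℕ) : Ideal (RX p) :=
  Ideal.span {comb (genE r (Q p) (N p)) (genE r (N p) (Q p))}

/-- The case II code `E₂`. -/
def E₂ (p r : ℕ) : Ideal (RX p) :=
  Ideal.span {comb (genE r (N p) (Q p)) (genE r (Q p) (N p))}

end QRCode

end

noncomputable section

namespace QRCode

/-! ### Monomial basis, cardinalities and multipliers of `RX p`. -/

section FreeModule

/-! Everything follows from idempotents. With `G = Q - N`, the group-ring Gauss sum, one has `G² = p
- J` (as -1 is a residue), `GJ = 0` and `J² = pJ`. As 2 is invertible modulo 9, `Q` and `N` are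
combinations of 1, `J`, `G`, so computing modulo 9 shows that `d(Q,N)` and `d(N,Q)` are idempotents
with product `K = cJ` and sum `1 + K`, where `c` inverts `p`, and that `e(A,B) = 1 - d(B,A)` for
these arguments (`genD_genE_relations`). Since `u` and `1 - u` are orthogonal idempotents, the same
holds for the generators `d₁`, `d₂` of the D-codes, and the E-codes are `(1 - d₂)` and `(1 - d₁)`.

Intersections and sums are then idempotent algebra. Duality is `dual_code_span`: a code `(e)` with
`e` idempotent and fixed by `X ↦ X⁻¹` has dual `(1 - e)`. Sizes come from `R_p = (d₁) ⊕ (1 - d₁)`,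
`(d₂) = (1 - d₁) ⊕ (K)`, `|(K)| = 81`, and a non-residue multiplier exchanging `d₁` and `d₂`. -/

theorem card_adjoinRoot {S : Type*} [CommRing S] {f : S[X]} (hf : f.Monic) :
    Nat.card (AdjoinRoot f) = Nat.card S ^ f.natDegree := by
  rw [Nat.card_congr (AdjoinRoot.powerBasis' hf).basis.equivFun.toEquiv, Nat.card_fun]
  simp

theorem card_R : Nat.card R = 81 := by
  have hm : (X ^ 2 - X : (ZMod 9)[X]).Monic := by monicity!
  have hd : (X ^ 2 - X : (ZMod 9)[X]).natDegree = 2 := by compute_degree!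
  rw [card_adjoinRoot hm, hd, Nat.card_zmod]
  norm_num

instance : Finite R := Nat.finite_of_card_ne_zero (by rw [card_R]; norm_num)

instance : Nontrivial R := Finite.one_lt_card_iff_nontrivial.mp (by rw [card_R]; norm_num)

theorem nine_eq_zero : (9 : R) = 0 := by
  rw [← map_ofNat (algebraMap (ZMod 9) R) 9, show (OfNat.ofNat 9 : ZMod 9) = 0 from rfl, map_zero]

theorem u_sq : u * u = u := by
  have h := AdjoinRoot.eval₂_root (X ^ 2 - X : (ZMod 9)[X])
  rw [eval₂_sub, eval₂_pow, eval₂_X, sub_eq_zero] at h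
  exact (sq u).symm.trans h

variable (p : ℕ)

theorem toPoly_apply (v : Fin p → R) : toPoly p v = ∑ i, v i • x p ^ (i : ℕ) := rfl

theorem natCast_sub_eq_zero (i j : Fin p) : ((i : ℕ) : ZMod p) - ((j : ℕ) : ZMod p) = 0 ↔
    i = j := by
  rw [sub_eq_zero, ZMod.natCast_eq_natCast_iff', Nat.mod_eq_of_lt i.2, Nat.mod_eq_of_lt j.2,
    Fin.ext_iff]

theorem mu_smul (a : ℕ) (c : R) (f : RX p) : mu p a (c • f) = c • mu p a f := by
  simp only [Algebra.smul_def, map_mul, AdjoinRoot.algebraMap_eq]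
  simp [mu]

theorem mu_comb (a : ℕ) (f g : RX p) : mu p a (comb f g) = comb (mu p a f) (mu p a g) := by
  simp only [comb, map_add, mu_smul]

variable [NeZero p]

theorem monic_X_pow_sub_one : (X ^ p - 1 : R[X]).Monic := monic_X_pow_sub_C 1 (NeZero.ne p)

theorem card_RX : Nat.card (RX p) = 81 ^ p := by
  rw [card_adjoinRoot (monic_X_pow_sub_one p), card_R]
  congr 1
  exact natDegree_X_pow_sub_C (r := (1 : R))

instance : Finite (RX p) :=
  Nat.finite_of_card_ne_zero (by rw [card_RX]; exact pow_ne_zero _ (by norm_num))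

/-- The monomial basis of `R_p`. -/
def monomialBasis : Module.Basis (Fin p) R (RX p) :=
  (AdjoinRoot.powerBasis' (monic_X_pow_sub_one p)).basis.reindex
    (finCongr (natDegree_X_pow_sub_C (r := (1 : R))))

theorem monomialBasis_apply (i : Fin p) : monomialBasis p i = x p ^ (i : ℕ) := by
  simp only [monomialBasis, x, Module.Basis.reindex_apply, AdjoinRoot.powerBasis'_gen,
    PowerBasis.basis_eq_pow]
  rfl

theorem toPoly_eq (v : Fin p → R) : toPoly p v = (monomialBasis p).equivFun.symm v := by
  simp [toPoly_apply, Module.Basis.equivFun_symm_apply, monomialBasis_apply]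

theorem toPoly_surjective : Function.Surjective (toPoly p) := fun f =>
  ⟨(monomialBasis p).equivFun f, by rw [toPoly_eq, LinearEquiv.symm_apply_apply]⟩

/-- The additive character `a ↦ X ^ a` of `ℤ/p`. -/
def char : AddChar (ZMod p) (RX p) := AddChar.zmodChar p (x_pow p)

theorem char_natCast (n : ℕ) : char p n = x p ^ n := AddChar.zmodChar_apply' (x_pow p) n

/-- The index of a residue class. -/
def index (a : ZMod p) : Fin p := ⟨a.val, a.val_lt⟩

theorem char_eq (a : ZMod p) : char p a = monomialBasis p (index p a) := by
  rw [monomialBasis_apply]; rfl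

/-- The constant coefficient. -/
def constCoeff : RX p →ₗ[R] R := (monomialBasis p).coord (index p 0)

theorem constCoeff_char (a : ZMod p) : constCoeff p (char p a) = if a = 0 then 1 else 0 := by
  have : index p a = index p 0 ↔ a = 0 := by
    simp only [index, Fin.mk.injEq]
    exact (ZMod.val_injective p).eq_iff
  rw [char_eq, constCoeff, Module.Basis.coord_apply, Module.Basis.repr_self,
    Finsupp.single_apply]
  simp only [this]

theorem toPoly_eq_char (v : Fin p → R) : toPoly p v = ∑ i, v i • char p ((i : ℕ) : ZMod p) := by
  simp only [toPoly_apply, char_natCast]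

/-- Multiplication by `X^(-j)` shifts the `j`-th coefficient into the constant place. -/
theorem constCoeff_toPoly_mul_char (v : Fin p → R) (j : Fin p) :
    constCoeff p (toPoly p v * char p (-((j : ℕ) : ZMod p))) = v j := by
  rw [toPoly_eq_char, Finset.sum_mul, map_sum]
  simp only [smul_mul_assoc, ← AddChar.map_add_eq_mul, map_smul, constCoeff_char, ← sub_eq_add_neg,
    natCast_sub_eq_zero]
  simp

theorem mu_char (a : ℕ) (b : ZMod p) : mu p a (char p b) = char p (a * b) := by
  have h : mu p a (x p) = x p ^ a := by simp [mu, x]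
  obtain ⟨n, rfl⟩ : ∃ n : ℕ, (n : ZMod p) = b := ⟨b.val, ZMod.natCast_zmod_val b⟩
  rw [← Nat.cast_mul, char_natCast, char_natCast, map_pow, h, pow_mul]

theorem mu_surjective {a : ℕ} (ha : IsUnit (a : ZMod p)) : Function.Surjective (mu p a) := by
  intro f
  obtain ⟨v, rfl⟩ := toPoly_surjective p f
  obtain ⟨b, hb⟩ := ha.exists_right_inv
  refine ⟨∑ i, v i • char p (b * ((i : ℕ) : ZMod p)), ?_⟩
  simp only [map_sum, mu_smul, mu_char, ← mul_assoc, hb, one_mul, toPoly_eq_char]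

theorem mu_injective {a : ℕ} (ha : IsUnit (a : ZMod p)) : Function.Injective (mu p a) :=
  Finite.injective_iff_surjective.mpr (mu_surjective p ha)

theorem mu_image_span {a : ℕ} (ha : IsUnit (a : ZMod p)) (g : RX p) :
    mu p a '' (Ideal.span {g} : Ideal (RX p)) = (Ideal.span {mu p a g} : Ideal (RX p)) := by
  rw [← Set.image_singleton, ← Ideal.map_span]
  ext y
  simp only [Set.mem_image, SetLike.mem_coe]
  exact (Ideal.mem_map_iff_of_surjective _ (mu_surjective p ha)).symm

theorem card_span_mu {a : ℕ} (ha : IsUnit (a : ZMod p)) (g : RX p) :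
    Nat.card (Ideal.span {mu p a g} : Ideal (RX p)) = Nat.card (Ideal.span {g} : Ideal (RX p)) := by
  have := Nat.card_image_of_injective (mu_injective p ha) (Ideal.span {g} : Ideal (RX p))
  rwa [mu_image_span p ha] at this

end FreeModule

/-! ### Euclidean duality for idempotent ideals. -/

section Dual

variable (p : ℕ) [NeZero p]

theorem natCast_pred : ((p - 1 : ℕ) : ZMod p) = -1 := by
  rw [Nat.cast_sub (Nat.one_le_iff_ne_zero.mpr (NeZero.ne p))]; simp

/-- Moves orthogonality into the ring: `mu p (p - 1)` is the involution `X ↦ X⁻¹`. -/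
theorem sum_mul_eq_constCoeff (v w : Fin p → R) :
    ∑ i, v i * w i = constCoeff p (toPoly p v * mu p (p - 1) (toPoly p w)) := by
  rw [toPoly_eq_char p w]
  simp only [map_sum, mu_smul, mu_char, natCast_pred, neg_one_mul, Finset.mul_sum, mul_smul_comm,
    map_smul, constCoeff_toPoly_mul_char, smul_eq_mul]
  simp only [mul_comm]

theorem mem_span_one_sub_iff {S : Type*} [CommRing S] {e : S} (he : e * e = e) (f : S) :
    f ∈ Ideal.span {1 - e} ↔ f * e = 0 := by
  rw [Ideal.mem_span_singleton']
  constructor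
  · rintro ⟨a, rfl⟩; linear_combination -a * he
  · exact fun h => ⟨f, by linear_combination -h⟩

/-- Pairing `v` with `e X^j` reads off the `j`-th coefficient of `v e`, so `v` is orthogonal to the
code exactly when `v e = 0`. -/
theorem dual_code_span {e : RX p} (he : e * e = e) (hmu : mu p (p - 1) e = e) :
    dual (code (Ideal.span {e})) = code (Ideal.span {1 - e}) := by
  ext v
  change (∀ c, toPoly p c ∈ Ideal.span {e} → ∑ i, v i * c i = 0) ↔
    toPoly p v ∈ Ideal.span {1 - e}
  rw [mem_span_one_sub_iff he]
  constructor
  · intro h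
    obtain ⟨w, hw⟩ := toPoly_surjective p (toPoly p v * e)
    rw [← hw]
    suffices w = 0 by rw [this, map_zero]
    funext j
    obtain ⟨c, hc⟩ := toPoly_surjective p (e * char p ((j : ℕ) : ZMod p))
    have := h c (by rw [hc]; exact Ideal.mul_mem_right _ _ (Ideal.mem_span_singleton_self e))
    rw [sum_mul_eq_constCoeff, hc, map_mul (mu p (p - 1)), hmu, mu_char, natCast_pred,
      neg_one_mul, ← mul_assoc, ← hw, constCoeff_toPoly_mul_char] at this
    exact this
  · intro h c hc
    obtain ⟨g, hg⟩ := Ideal.mem_span_singleton'.mp hc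
    rw [sum_mul_eq_constCoeff, ← hg, map_mul (mu p (p - 1)), hmu, mul_comm _ e, ← mul_assoc, h,
      zero_mul, map_zero]

end Dual

/-! ### Ideals generated by idempotents. -/

section Idempotents

variable {S : Type*} [CommRing S] {a b : S}

theorem span_add_of_orthogonal (ha : a * a = a) (hb : b * b = b) (hab : a * b = 0) :
    Ideal.span {a + b} = Ideal.span {a} ⊔ Ideal.span {b} := by
  apply le_antisymm
  · rw [Ideal.span_singleton_le_iff_mem]
    exact Submodule.add_mem_sup (Ideal.mem_span_singleton_self a) (Ideal.mem_span_singleton_self b)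
  · refine sup_le ?_ ?_ <;> rw [Ideal.span_singleton_le_iff_mem, Ideal.mem_span_singleton']
    · exact ⟨a, by linear_combination ha + hab⟩
    · exact ⟨b, by linear_combination hb + hab⟩

theorem span_inf_span_of_idempotent (ha : a * a = a) (hb : b * b = b) :
    Ideal.span {a} ⊓ Ideal.span {b} = Ideal.span {a * b} := by
  ext f
  simp only [Ideal.mem_inf, Ideal.mem_span_singleton']
  constructor
  · rintro ⟨⟨s, hs⟩, ⟨t, ht⟩⟩
    -- From `f = s a = t b` one gets `f a = f = f b`, so `f = f (a b)`.
    exact ⟨f, by linear_combination a * (t * hb - b * ht + ht) + s * ha - a * hs + hs⟩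
  · rintro ⟨s, rfl⟩
    exact ⟨⟨s * b, by ring⟩, ⟨s * a, by ring⟩⟩

/-- The sum is direct: multiplying by `a` or by `b` recovers the corresponding summand. -/
theorem card_span_add_of_orthogonal (ha : a * a = a) (hb : b * b = b) (hab : a * b = 0) :
    Nat.card (Ideal.span {a + b} : Ideal S) =
      Nat.card (Ideal.span {a} : Ideal S) * Nat.card (Ideal.span {b} : Ideal S) := by
  rw [← Nat.card_prod]
  symm
  refine Nat.card_congr (Equiv.ofBijective
    (fun s : (Ideal.span {a} : Ideal S) × (Ideal.span {b} : Ideal S) =>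
      (⟨s.1 + s.2, by
        rw [span_add_of_orthogonal ha hb hab]
        exact Submodule.add_mem_sup s.1.2 s.2.2⟩ : (Ideal.span {a + b} : Ideal S))) ⟨?_, ?_⟩)
  · rintro ⟨⟨s, hs⟩, ⟨t, ht⟩⟩ ⟨⟨s', hs'⟩, ⟨t', ht'⟩⟩ h
    obtain ⟨s, rfl⟩ := Ideal.mem_span_singleton'.mp hs
    obtain ⟨t, rfl⟩ := Ideal.mem_span_singleton'.mp ht
    obtain ⟨s', rfl⟩ := Ideal.mem_span_singleton'.mp hs'
    obtain ⟨t', rfl⟩ := Ideal.mem_span_singleton'.mp ht'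
    simp only [Subtype.mk.injEq, Prod.mk.injEq] at h ⊢
    constructor
    · linear_combination a * h - (s - s') * ha - (t - t') * hab
    · linear_combination b * h - (t - t') * hb - (s - s') * hab
  · rintro ⟨f, hf⟩
    obtain ⟨f, rfl⟩ := Ideal.mem_span_singleton'.mp hf
    exact ⟨⟨⟨f * a, Ideal.mul_mem_left _ _ (Ideal.mem_span_singleton_self a)⟩,
      ⟨f * b, Ideal.mul_mem_left _ _ (Ideal.mem_span_singleton_self b)⟩⟩,
      Subtype.ext (by simp only; ring)⟩

end Idempotents
-- The sums `Q`, `N`, `J` as sums over `ZMod p`.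
section QuadraticSums

theorem nine_eq_zero_RX (p : ℕ) : (9 : RX p) = 0 := by
  rw [← map_ofNat (algebraMap R (RX p)) 9, show (OfNat.ofNat 9 : R) = 0 from nine_eq_zero, map_zero]

variable (p : ℕ) [NeZero p]

theorem sum_filter_range (P : ZMod p → Prop) [DecidablePred P] :
    ∑ i ∈ (Finset.range p).filter (fun i : ℕ => P i), x p ^ i =
      ∑ a, if P a then char p a else 0 := by
  rw [← Finset.sum_filter]
  refine Finset.sum_nbij' (fun i : ℕ => (i : ZMod p)) ZMod.val ?_ ?_ ?_ ?_ ?_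
  · simp
  · simp [ZMod.val_lt]
  · intro i hi
    rw [Finset.mem_filter, Finset.mem_range] at hi
    exact ZMod.val_cast_of_lt hi.1
  · simp
  · intro i _
    rw [char_natCast]

open Classical in
theorem Q_eq : Q p = ∑ a, if a ∈ residues p then char p a else 0 := by
  rw [Q, sum_filter_range p (fun a => a ∈ residues p)]

open Classical in
theorem N_eq : N p = ∑ a, if a ∈ nonresidues p then char p a else 0 := by
  rw [N, sum_filter_range p (fun a => a ∈ nonresidues p)]

theorem J_eq : J p = ∑ a, char p a := by
  classical
  rw [J, Q_eq, N_eq, add_assoc, ← Finset.sum_add_distrib,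
    ← AddChar.map_zero_eq_one (char p), ← Fintype.sum_ite_eq' 0 (char p), ← Finset.sum_add_distrib]
  refine Finset.sum_congr rfl fun a _ => ?_
  by_cases h0 : a = 0
  · subst h0; simp [residues, nonresidues]
  · by_cases ha : IsSquare a <;> simp [residues, nonresidues, h0, ha]

theorem char_mul_J (a : ZMod p) : char p a * J p = J p := by
  rw [J_eq, Finset.mul_sum]
  exact Fintype.sum_equiv (Equiv.addLeft a) _ _ fun b => by
    rw [← AddChar.map_add_eq_mul]; rfl

theorem J_mul_J : J p * J p = p * J p := by
  nth_rw 1 [J_eq]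
  rw [Finset.sum_mul]
  simp [char_mul_J]

theorem constCoeff_J : constCoeff p (J p) = 1 := by
  simp [J_eq, constCoeff_char]

theorem toPoly_mul_J (v : Fin p → R) : toPoly p v * J p = (∑ i, v i) • J p := by
  simp only [toPoly_eq_char, Finset.sum_mul, smul_mul_assoc, char_mul_J, Finset.sum_smul]

/-- Every multiple of `J` is a scalar multiple, by the coefficient sum, so the ideal is free of rank
one over `R`. -/
theorem card_span_smul_J {c : R} (hc : IsUnit c) :
    Nat.card (Ideal.span {c • J p} : Ideal (RX p)) = 81 := by
  rw [← card_R]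
  symm
  refine Nat.card_congr (Equiv.ofBijective
    (fun s : R => (⟨s • c • J p, by
      rw [← smul_one_mul s (c • J p)]
      exact Ideal.mul_mem_left _ _ (Ideal.mem_span_singleton_self _)⟩ :
        (Ideal.span {c • J p} : Ideal (RX p)))) ⟨?_, ?_⟩)
  · intro s t h
    have := congrArg (constCoeff p) (Subtype.ext_iff.mp h)
    simp only [map_smul, constCoeff_J, smul_eq_mul, mul_one] at this
    exact hc.mul_right_cancel this
  · rintro ⟨f, hf⟩
    obtain ⟨g, rfl⟩ := Ideal.mem_span_singleton'.mp hf
    obtain ⟨v, rfl⟩ := toPoly_surjective p g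
    refine ⟨∑ i, v i, Subtype.ext ?_⟩
    simp only [mul_smul_comm, toPoly_mul_J, smul_comm c]

end QuadraticSums

/-! ### Quadratic character and the Gauss sum `Q - N`. -/

section PrimeLength

variable {p : ℕ} [Fact p.Prime]

theorem mem_residues_iff {a : ZMod p} : a ∈ residues p ↔ quadraticChar (ZMod p) a = 1 := by
  change a ≠ 0 ∧ IsSquare a ↔ _
  by_cases h0 : a = 0
  · simp [h0]
  · rw [quadraticChar_one_iff_isSquare h0, and_iff_right h0]

theorem mem_nonresidues_iff {a : ZMod p} :
    a ∈ nonresidues p ↔ quadraticChar (ZMod p) a = -1 := by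
  rw [quadraticChar_neg_one_iff_not_isSquare]; rfl

theorem ne_zero_of_mem_residues {a : ZMod p} (ha : a ∈ residues p) : a ≠ 0 := ha.1

theorem ne_zero_of_mem_nonresidues {a : ZMod p} (ha : a ∈ nonresidues p) : a ≠ 0 := by
  rintro rfl
  simp [nonresidues] at ha

theorem mu_sum_ite {a : ℕ} (ha : (a : ZMod p) ≠ 0) {P P' : ZMod p → Prop} [DecidablePred P]
    [DecidablePred P'] (h : ∀ b, P b ↔ P' (a * b)) :
    mu p a (∑ b, if P b then char p b else 0) = ∑ b, if P' b then char p b else 0 := by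
  simp only [map_sum, apply_ite (mu p a), map_zero, mu_char]
  exact Fintype.sum_equiv (Equiv.mulLeft₀ (a : ZMod p) ha) _ _ fun b => if_congr (h b) rfl rfl

theorem mu_Q_of_mem_residues {a : ℕ} (ha : (a : ZMod p) ∈ residues p) : mu p a (Q p) = Q p := by
  classical
  rw [Q_eq]
  refine mu_sum_ite (ne_zero_of_mem_residues ha) fun b => ?_
  rw [mem_residues_iff, mem_residues_iff, map_mul, mem_residues_iff.mp ha, one_mul]

theorem mu_N_of_mem_residues {a : ℕ} (ha : (a : ZMod p) ∈ residues p) : mu p a (N p) = N p := by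
  classical
  rw [N_eq]
  refine mu_sum_ite (ne_zero_of_mem_residues ha) fun b => ?_
  rw [mem_nonresidues_iff, mem_nonresidues_iff, map_mul, mem_residues_iff.mp ha, one_mul]

theorem mu_Q_of_mem_nonresidues {a : ℕ} (ha : (a : ZMod p) ∈ nonresidues p) :
    mu p a (Q p) = N p := by
  classical
  rw [Q_eq, N_eq]
  refine mu_sum_ite (ne_zero_of_mem_nonresidues ha) fun b => ?_
  rw [mem_residues_iff, mem_nonresidues_iff, map_mul, mem_nonresidues_iff.mp ha, neg_one_mul,
    neg_inj]

theorem mu_N_of_mem_nonresidues {a : ℕ} (ha : (a : ZMod p) ∈ nonresidues p) :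
    mu p a (N p) = Q p := by
  classical
  rw [Q_eq, N_eq]
  refine mu_sum_ite (ne_zero_of_mem_nonresidues ha) fun b => ?_
  rw [mem_residues_iff, mem_nonresidues_iff, map_mul, mem_nonresidues_iff.mp ha, neg_one_mul,
    neg_eq_iff_eq_neg]

theorem Q_sub_N_eq : Q p - N p = ∑ a, quadraticChar (ZMod p) a • char p a := by
  classical
  rw [Q_eq, N_eq, ← Finset.sum_sub_distrib]
  refine Finset.sum_congr rfl fun a _ => ?_
  simp only [mem_residues_iff, mem_nonresidues_iff]
  by_cases h0 : a = 0
  · simp [h0]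
  · rcases quadraticChar_dichotomy h0 with h | h <;> simp [h]

theorem Q_sub_N_mul_J (hp : p ≠ 2) : (Q p - N p) * J p = 0 := by
  rw [Q_sub_N_eq, Finset.sum_mul]
  simp only [smul_mul_assoc, char_mul_J, ← Finset.sum_smul]
  rw [quadraticChar_sum_zero (by rwa [ZMod.ringChar_zmod_n]), zero_smul]

/-- The correlations of the quadratic character of a prime congruent to `1` modulo `4`. -/
theorem sum_quadraticChar_mul_sub (hp : p ≠ 2) (h1 : quadraticChar (ZMod p) (-1) = 1)
    (c : ZMod p) :
    ∑ a, quadraticChar (ZMod p) a * quadraticChar (ZMod p) (c - a) =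
      (if c = 0 then (p : ℤ) else 0) - 1 := by
  have hχ : quadraticChar (ZMod p) ≠ 1 := quadraticChar_ne_one (by rwa [ZMod.ringChar_zmod_n])
  by_cases hc : c = 0
  · have h (a : ZMod p) : quadraticChar (ZMod p) a * quadraticChar (ZMod p) (0 - a) =
        1 - if a = 0 then 1 else 0 := by
      rw [zero_sub, ← neg_one_mul a, map_mul, h1, one_mul, ← sq]
      by_cases ha : a = 0
      · simp [ha]
      · rw [quadraticChar_sq_one ha, if_neg ha, sub_zero]
    simp only [hc, h, Finset.sum_sub_distrib]
    simp
  · have h := jacobiSum_nontrivial_inv hχ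
    -- The Jacobi sum of χ and χ⁻¹ = χ is `-χ(-1) = -1`; substituting `c a` for `a` reduces the
    -- correlation to it, with factor `χ(c)² = 1`.
    rw [(quadraticChar_isQuadratic (ZMod p)).inv, h1, jacobiSum] at h
    rw [if_neg hc, zero_sub, ← h]
    refine (Fintype.sum_equiv (Equiv.mulLeft₀ c hc) _ _ fun a => ?_).symm
    have : c - c * a = c * (1 - a) := by ring
    simp only [Equiv.mulLeft₀_apply, this, map_mul]
    linear_combination -quadraticChar (ZMod p) a * quadraticChar (ZMod p) (1 - a) *
      quadraticChar_sq_one hc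

/-- The coefficients of the square are the correlations of χ: `p - 1` at 0 and `-1` elsewhere. -/
theorem Q_sub_N_sq (hp : p ≠ 2) (h1 : quadraticChar (ZMod p) (-1) = 1) :
    (Q p - N p) * (Q p - N p) = p - J p := by
  have h (a : ZMod p) : ∑ b, (quadraticChar (ZMod p) a • char p a) *
      (quadraticChar (ZMod p) b • char p b) =
      ∑ c, (quadraticChar (ZMod p) a * quadraticChar (ZMod p) (c - a)) • char p c :=
    Fintype.sum_equiv (Equiv.addLeft a) _ _ fun b => by
      rw [smul_mul_smul_comm, ← AddChar.map_add_eq_mul]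
      simp
  rw [Q_sub_N_eq, Finset.sum_mul_sum]
  simp only [h]
  rw [Finset.sum_comm]
  simp only [← Finset.sum_smul, sum_quadraticChar_mul_sub hp h1, sub_smul, one_smul,
    Finset.sum_sub_distrib, ← J_eq]
  simp [ite_smul]

end PrimeLength

/-! ### Idempotent relations between the generators. -/

section Generators

theorem mu_genD {p : ℕ} (n r : ℕ) (a b : RX p) :
    mu p n (genD r a b) = genD r (mu p n a) (mu p n b) := by
  have h (k : ℕ) [k.AtLeastTwo] : mu p n (OfNat.ofNat k) = OfNat.ofNat k := map_ofNat _ k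
  unfold genD; split <;> simp only [map_add, map_mul, map_one, h]

theorem mu_genE {p : ℕ} (n r : ℕ) (a b : RX p) :
    mu p n (genE r a b) = genE r (mu p n a) (mu p n b) := by
  have h (k : ℕ) [k.AtLeastTwo] : mu p n (OfNat.ofNat k) = OfNat.ofNat k := map_ofNat _ k
  unfold genE; split <;> simp only [map_add, map_mul, h]

theorem comb_mul {p : ℕ} (a b a' b' : RX p) : comb a b * comb a' b' = comb (a * a') (b * b') := by
  have h : algebraMap R (RX p) u * algebraMap R (RX p) u = algebraMap R (RX p) u := by
    rw [← map_mul, u_sq]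
  simp only [comb, Algebra.smul_def, map_sub, map_one]
  linear_combination (a - b) * (a' - b') * h

theorem comb_add {p : ℕ} (a b a' b' : RX p) : comb a b + comb a' b' = comb (a + a') (b + b') := by
  simp only [comb, smul_add]; abel

theorem comb_self {p : ℕ} (a : RX p) : comb a a = a := by
  rw [comb, ← add_smul, add_sub_cancel, one_smul]

/-- The components of the generators of `D₁`, `D₂` are idempotents whose product is `K = c J` and
whose sum is `1 + K`; the components of the generators of `E₁`, `E₂` are their complements. -/
theorem genD_genE_relations {p r : ℕ} (hpr : p = 12 * r + 1)
    (hJJ : J p * J p = p * J p) (hGJ : (Q p - N p) * J p = 0)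
    (hGG : (Q p - N p) * (Q p - N p) = p - J p) :
    ∃ c : R, IsUnit c ∧ c • J p ∈ ({J p, 4 * J p, 7 * J p} : Set (RX p)) ∧
      genD r (Q p) (N p) * genD r (Q p) (N p) = genD r (Q p) (N p) ∧
      genD r (N p) (Q p) * genD r (N p) (Q p) = genD r (N p) (Q p) ∧
      genD r (Q p) (N p) * genD r (N p) (Q p) = c • J p ∧
      genD r (Q p) (N p) + genD r (N p) (Q p) = 1 + c • J p ∧
      genE r (Q p) (N p) = 1 - genD r (N p) (Q p) ∧
      genE r (N p) (Q p) = 1 - genD r (Q p) (N p) := by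
  have h9 := nine_eq_zero_RX p
  have h9R := nine_eq_zero
  obtain ⟨k, hk⟩ : ∃ k, r = 3 * k + r % 3 := ⟨r / 3, by omega⟩
  -- `12 r + 1 = 36 k + 12 (r % 3) + 1`, reduced modulo 9.
  have hp9 : (p : RX p) = 1 + 3 * ((r % 3 : ℕ) : RX p) := by
    have h : (p : RX p) = ((12 * (3 * k + r % 3) + 1 : ℕ) : RX p) := by rw [← hk, ← hpr]
    push_cast at h
    linear_combination h + (4 * (k : RX p) + ((r % 3 : ℕ) : RX p)) * h9
  -- 5 is the inverse of 2 modulo 9, and `Q + N = J - 1`.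
  have hQ : Q p = 5 * (J p - 1 + (Q p - N p)) := by
    rw [J]; linear_combination (-Q p) * h9
  have hN : N p = 5 * (J p - 1 - (Q p - N p)) := by
    rw [J]; linear_combination (-N p) * h9
  rw [hp9] at hJJ hGG
  generalize Q p - N p = G at *
  generalize J p = j at *
  generalize Q p = q at *
  generalize N p = n at *
  subst hQ hN
  have h4 : algebraMap R (RX p) 4 = 4 := map_ofNat _ 4
  have h7 : algebraMap R (RX p) 7 = 7 := map_ofNat _ 7
  have hs : r % 3 = 0 ∨ r % 3 = 1 ∨ r % 3 = 2 := by omega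
  rcases hs with hr | hr | hr <;> rw [hr] at hJJ hGG <;> push_cast at hJJ hGG <;>
    simp only [genD, genE, hr, Algebra.smul_def]
  -- The witness `c` is the inverse of `p` modulo 9: 1, 7, 4 for `p ≡ 1, 4, 7`. The coefficients of
  -- `hJJ`, `hGJ`, `hGG` come from expanding squares and products of expressions linear in `j` and
  -- `G`; the `h9` term absorbs multiples of 9.
  · refine ⟨1, isUnit_one, ?_, ?_, ?_, ?_, ?_, ?_, ?_⟩ <;> try simp only [map_one, one_mul]
    · simp
    · linear_combination 25 * hJJ + 50 * hGJ + 25 * hGG + (-5 * j + 5 - 5 * G) * h9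
    · linear_combination 25 * hJJ - 50 * hGJ + 25 * hGG + (-5 * j + 5 + 5 * G) * h9
    · linear_combination 25 * hJJ - 25 * hGG + (j - 1) * h9
    · linear_combination (j - 1) * h9
    · linear_combination (5 * j - 5 - 5 * G) * h9
    · linear_combination (5 * j - 5 + 5 * G) * h9
  · refine ⟨7, IsUnit.of_mul_eq_one 4 (by linear_combination 3 * h9R),
      ?_, ?_, ?_, ?_, ?_, ?_, ?_⟩ <;>
      try simp only [h7]
    · simp
    · linear_combination 1225 * hJJ - 1750 * hGJ + 625 * hGG + (230 * j + 388 + 175 * G) * h9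
    · linear_combination 1225 * hJJ + 1750 * hGJ + 625 * hGG + (230 * j + 388 - 175 * G) * h9
    · linear_combination 1225 * hJJ - 625 * hGG + (372 * j - 171) * h9
    · linear_combination (7 * j - 7) * h9
    · linear_combination (10 * j - 9) * h9
    · linear_combination (10 * j - 9) * h9
  · refine ⟨4, IsUnit.of_mul_eq_one 7 (by linear_combination 3 * h9R),
      ?_, ?_, ?_, ?_, ?_, ?_, ?_⟩ <;>
      try simp only [h4]
    · simp
    · linear_combination 400 * hJJ - 400 * hGJ + 100 * hGG + (240 * j + 98 + 30 * G) * h9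
    · linear_combination 400 * hJJ + 400 * hGJ + 100 * hGG + (240 * j + 98 - 30 * G) * h9
    · linear_combination 400 * hJJ - 100 * hGG + (264 * j - 59) * h9
    · linear_combination (4 * j - 3) * h9
    · linear_combination (10 * j - 9) * h9
    · linear_combination (10 * j - 9) * h9


end Generators
end QRCode

end

/-! ### Assembly of the six assertions. -/

open QRCode in
theorem theorem6 (p r : ℕ) (hp : p.Prime) (hpr : p = 12 * r + 1) :
    (∀ a : ℕ, (a : ZMod p) ∈ residues p →
      mu p a '' (D₁ p r) = D₁ p r ∧ mu p a '' (D₂ p r) = D₂ p r ∧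
      mu p a '' (E₁ p r) = E₁ p r ∧ mu p a '' (E₂ p r) = E₂ p r) ∧
    (∀ a : ℕ, (a : ZMod p) ∈ nonresidues p →
      mu p a '' (D₁ p r) = D₂ p r ∧ mu p a '' (E₁ p r) = E₂ p r) ∧
    (∃ K : RX p, K ∈ ({J p, 4 * J p, 7 * J p} : Set (RX p)) ∧
      (D₁ p r ⊓ D₂ p r = Ideal.span {K} ∧ D₁ p r ⊔ D₂ p r = ⊤) ∧
      (E₁ p r ⊓ E₂ p r = ⊥ ∧ code (E₁ p r ⊔ E₂ p r) = dual (code (Ideal.span {K}))) ∧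
      (D₁ p r = E₁ p r ⊔ Ideal.span {K} ∧ D₂ p r = E₂ p r ⊔ Ideal.span {K})) ∧
    (Nat.card (D₁ p r) = 9 ^ (p + 1) ∧ Nat.card (D₂ p r) = 9 ^ (p + 1) ∧
      Nat.card (E₁ p r) = 9 ^ (p - 1) ∧ Nat.card (E₂ p r) = 9 ^ (p - 1)) ∧
    (dual (code (E₁ p r)) = code (D₂ p r) ∧ dual (code (E₂ p r)) = code (D₁ p r)) := by
  have : Fact p.Prime := ⟨hp⟩
  have hp2 : p ≠ 2 := by omega
  have h1 : quadraticChar (ZMod p) (-1) = 1 := by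
    rw [quadraticChar_one_iff_isSquare (neg_ne_zero.mpr one_ne_zero), ZMod.exists_sq_eq_neg_one_iff]
    omega
  have hunit {a : ℕ} (ha : (a : ZMod p) ∈ residues p) : IsUnit (a : ZMod p) :=
    (ne_zero_of_mem_residues ha).isUnit
  have hunit' {a : ℕ} (ha : (a : ZMod p) ∈ nonresidues p) : IsUnit (a : ZMod p) :=
    (ne_zero_of_mem_nonresidues ha).isUnit
  -- -1 is a residue, so all generators are fixed by `X ↦ X⁻¹`, as `dual_code_span` requires.
  have hneg : ((p - 1 : ℕ) : ZMod p) ∈ residues p := by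
    rw [natCast_pred, mem_residues_iff, h1]
  obtain ⟨n, hn⟩ : ∃ n : ℕ, (n : ZMod p) ∈ nonresidues p := by
    obtain ⟨a, ha⟩ := quadraticChar_exists_neg_one (F := ZMod p) (by rwa [ZMod.ringChar_zmod_n])
    exact ⟨a.val, by rwa [ZMod.natCast_zmod_val, mem_nonresidues_iff]⟩
  obtain ⟨c, hc, hK, hd, hd', hdd', hadd, he, he'⟩ :=
    genD_genE_relations hpr (J_mul_J p) (Q_sub_N_mul_J hp2) (Q_sub_N_sq hp2 h1)
  have hres (a : ℕ) (ha : (a : ZMod p) ∈ residues p) :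
      mu p a '' (D₁ p r) = D₁ p r ∧ mu p a '' (D₂ p r) = D₂ p r ∧
      mu p a '' (E₁ p r) = E₁ p r ∧ mu p a '' (E₂ p r) = E₂ p r := by
    simp only [D₁, D₂, E₁, E₂, mu_image_span p (hunit ha), mu_comb, mu_genD, mu_genE,
      mu_Q_of_mem_residues ha, mu_N_of_mem_residues ha, and_self]
  have hnonres (a : ℕ) (ha : (a : ZMod p) ∈ nonresidues p) :
      mu p a '' (D₁ p r) = D₂ p r ∧ mu p a '' (E₁ p r) = E₂ p r := by
    simp only [D₁, D₂, E₁, E₂, mu_image_span p (hunit' ha), mu_comb, mu_genD, mu_genE,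
      mu_Q_of_mem_nonresidues ha, mu_N_of_mem_nonresidues ha, and_self]
  refine ⟨hres, hnonres, ?_⟩
  have hmuD₁ : mu p n (comb (genD r (Q p) (N p)) (genD r (N p) (Q p))) =
      comb (genD r (N p) (Q p)) (genD r (Q p) (N p)) := by
    simp only [mu_comb, mu_genD, mu_Q_of_mem_nonresidues hn, mu_N_of_mem_nonresidues hn]
  have hnegD₁ : mu p (p - 1) (comb (genD r (Q p) (N p)) (genD r (N p) (Q p))) =
      comb (genD r (Q p) (N p)) (genD r (N p) (Q p)) := by
    simp only [mu_comb, mu_genD, mu_Q_of_mem_residues hneg, mu_N_of_mem_residues hneg]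
  have hnegD₂ : mu p (p - 1) (comb (genD r (N p) (Q p)) (genD r (Q p) (N p))) =
      comb (genD r (N p) (Q p)) (genD r (Q p) (N p)) := by
    simp only [mu_comb, mu_genD, mu_Q_of_mem_residues hneg, mu_N_of_mem_residues hneg]
  have hD₁ : D₁ p r = Ideal.span {comb (genD r (Q p) (N p)) (genD r (N p) (Q p))} := rfl
  have hD₂ : D₂ p r = Ideal.span {comb (genD r (N p) (Q p)) (genD r (Q p) (N p))} := rfl
  have hidem₁ := comb_mul (genD r (Q p) (N p)) (genD r (N p) (Q p)) (genD r (Q p) (N p))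
    (genD r (N p) (Q p))
  have hidem₂ := comb_mul (genD r (N p) (Q p)) (genD r (Q p) (N p)) (genD r (N p) (Q p))
    (genD r (Q p) (N p))
  have hprod := comb_mul (genD r (Q p) (N p)) (genD r (N p) (Q p)) (genD r (N p) (Q p))
    (genD r (Q p) (N p))
  have hsum := comb_add (genD r (Q p) (N p)) (genD r (N p) (Q p)) (genD r (N p) (Q p))
    (genD r (Q p) (N p))
  rw [hd, hd'] at hidem₁ hidem₂
  rw [mul_comm (genD r (N p) (Q p)), hdd', comb_self] at hprod
  rw [add_comm (genD r (N p) (Q p)), hadd, comb_self] at hsum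
  have hcomb_sub (a b : RX p) : comb (1 - a) (1 - b) = 1 - comb a b := by
    rw [eq_sub_iff_add_eq, comb_add, sub_add_cancel, sub_add_cancel, comb_self]
  have hE₁ : E₁ p r = Ideal.span {1 - comb (genD r (N p) (Q p)) (genD r (Q p) (N p))} := by
    rw [E₁, he, he', hcomb_sub]
  have hE₂ : E₂ p r = Ideal.span {1 - comb (genD r (Q p) (N p)) (genD r (N p) (Q p))} := by
    rw [E₂, he, he', hcomb_sub]
  have hcardK := card_span_smul_J p hc
  generalize comb (genD r (Q p) (N p)) (genD r (N p) (Q p)) = d₁ at *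
  generalize comb (genD r (N p) (Q p)) (genD r (Q p) (N p)) = d₂ at *
  generalize c • J p = K at *
  have hKK : K * K = K := by rw [← hprod]; linear_combination d₁ * d₁ * hidem₂ + d₂ * hidem₁
  have hnegK : mu p (p - 1) K = K := by rw [← hprod, map_mul, hnegD₁, hnegD₂]
  have hf₁ : (1 - d₁) * (1 - d₁) = 1 - d₁ := by linear_combination hidem₁
  have hf₂ : (1 - d₂) * (1 - d₂) = 1 - d₂ := by linear_combination hidem₂
  have hff : (1 - d₂) * (1 - d₁) = 0 := by linear_combination hprod - hsum
  have hfK₁ : (1 - d₁) * K = 0 := by rw [← hprod]; linear_combination -d₂ * hidem₁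
  have hfK₂ : (1 - d₂) * K = 0 := by rw [← hprod]; linear_combination -d₁ * hidem₂
  -- These orthogonal splittings give both `D = E + (K)` and `|D| = 81 |E|`.
  have hd₁K : d₁ = 1 - d₂ + K := by linear_combination hsum
  have hd₂K : d₂ = 1 - d₁ + K := by linear_combination hsum
  have hcardD : Nat.card (D₂ p r) = Nat.card (D₁ p r) := by
    rw [hD₁, hD₂, ← hmuD₁, card_span_mu p (hunit' hn)]
  have hcardDE₁ : Nat.card (D₁ p r) = Nat.card (E₁ p r) * 81 := by
    rw [← hcardK, hE₁, ← card_span_add_of_orthogonal hf₂ hKK hfK₂, ← hd₁K, hD₁]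
  have hcardDE₂ : Nat.card (D₂ p r) = Nat.card (E₂ p r) * 81 := by
    rw [← hcardK, hE₂, ← card_span_add_of_orthogonal hf₁ hKK hfK₁, ← hd₂K, hD₂]
  have hcardTop : Nat.card (D₁ p r) * Nat.card (E₂ p r) = 81 ^ p := by
    rw [hD₁, hE₂, ← card_span_add_of_orthogonal hidem₁ hf₁ (by linear_combination -hidem₁),
      add_sub_cancel, Ideal.span_singleton_one, ← card_RX p]
    exact Nat.card_congr Submodule.topEquiv.toEquiv
  have hcardE : Nat.card (E₂ p r) = 9 ^ (p - 1) := by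
    have hE : Nat.card (D₁ p r) = Nat.card (E₂ p r) * 81 := by rw [← hcardD, hcardDE₂]
    have h81 : (81 : ℕ) ^ p = (9 ^ (p - 1)) ^ 2 * 81 := by
      obtain ⟨q, hq⟩ : ∃ q, p = q + 1 := ⟨p - 1, by omega⟩
      rw [hq, Nat.add_sub_cancel, ← pow_mul, mul_comm q 2, pow_mul, pow_succ]
      norm_num
    -- The product `|D₁| |E₂| = 81 ^ p` becomes an equation for `|E₂|²`.
    rw [hE, h81] at hcardTop
    have : Nat.card (E₂ p r) ^ 2 = (9 ^ (p - 1)) ^ 2 := by nlinarith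
    exact Nat.pow_left_injective two_ne_zero this
  have h9 : (9 : ℕ) ^ (p - 1) * 81 = 9 ^ (p + 1) := by
    rw [show p + 1 = p - 1 + 2 by omega, pow_add]
    norm_num
  refine ⟨⟨K, hK, ⟨?_, ?_⟩, ⟨?_, ?_⟩, ?_, ?_⟩, ⟨?_, ?_, ?_, hcardE⟩, ?_, ?_⟩
  · rw [hD₁, hD₂, span_inf_span_of_idempotent hidem₁ hidem₂, hprod]
  -- `d₁ + d₂ - d₁ d₂ = (1 + K) - K = 1`.
  · rw [Ideal.eq_top_iff_one, show (1 : RX p) = d₁ + (1 - d₁) * d₂ by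
      linear_combination hprod - hsum]
    exact Submodule.add_mem_sup (hD₁ ▸ Ideal.mem_span_singleton_self _)
      (hD₂ ▸ Ideal.mul_mem_left _ _ (Ideal.mem_span_singleton_self _))
  · rw [hE₁, hE₂, span_inf_span_of_idempotent hf₂ hf₁, hff, Ideal.span_singleton_eq_bot]
  · rw [hE₁, hE₂, ← span_add_of_orthogonal hf₂ hf₁ hff, dual_code_span p hKK hnegK,
      show 1 - d₂ + (1 - d₁) = 1 - K by linear_combination -hsum]
  · rw [hE₁, ← span_add_of_orthogonal hf₂ hKK hfK₂, ← hd₁K, hD₁]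
  · rw [hE₂, ← span_add_of_orthogonal hf₁ hKK hfK₁, ← hd₂K, hD₂]
  · rw [← hcardD, hcardDE₂, hcardE, h9]
  · rw [hcardDE₂, hcardE, h9]
  · rw [← hcardE]; omega
  · rw [hE₁, dual_code_span p hf₂ (by rw [map_sub, map_one, hnegD₂]), sub_sub_cancel, hD₂]
  · rw [hE₂, dual_code_span p hf₁ (by rw [map_sub, map_one, hnegD₁]), sub_sub_cancel, hD₁]
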